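/- Let $d\ge 0$ and $r\ge 0$ be integers with $r<\frac{d+2}{2}$. For $h=(h_0,\dots,h_d)\in\mathbb{C}^{d+1}$ the first characteristic degree of $h$ is the smallest integer $s\ge 0$ for which there is a nonzero vector $(q_0,\dots,q_s)\in\mathbb{C}^{s+1}$ with $$q_0h_k+q_1h_{k+1}+\cdots+q_sh_{k+s}=0\qquad\text{for all integers }k\text{ with }0\le k\le d-s;$$ such a vector with this smallest $s$ is called a characteristic vector of $h$. For $p=(p_1,\dots,p_d)\in\mathbb{C}^d$ let $\mathscr{S}_h(p)=[h_{i+j}]_{i,j=0}^{d}$ be the $(d+1)\times(d+1)$ Hankel matrix in which $h_0,\dots,h_d$ are given and the missing entries are $h_{d+i}:=p_i$, $1\le i\le d$. Let $\|\cdot\|_*$ denote the nuclear norm (sum of singular values). There exists $\rho=\rho(d,r)>0$, depending only on $d$ and $r$, such that the following holds for every $h\in\mathbb{C}^{d+1}$ whose first characteristic degree is $r$ and every characteristic vector $q=(q_0,\dots,q_r)$ of $h$ with $q_r\ne 0$: if all roots $\lambda_k\in\mathbb{C}$ of the characteristic polynomial $q(z)=\sum_{j=0}^r q_jz^j$ satisfy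 $|\lambda_k|<\rho$, then the nuclear norm minimization problem $$\min_{p\in\mathbb{C}^d}\|\mathscr{S}_h(p)\|_*$$ has exactly one solution, and this solution is the recursive completion given by $$h_{k+r}=-\frac{1}{q_r}\bigl(q_0h_k+\cdots+q_{r-1}h_{k+r-1}\bigr),\qquad d-r<k\le 2d-r.$$ Moreover, this completion has rank $r$, which is the minimal rank of $\mathscr{S}_h(p)$ over all $p\in\mathbb{C}^d$. -/

import Mathlib

open Polynomial

noncomputable section

/-- The linear recurrence `q₀ h_k + ⋯ + q_r h_{k+r} = 0` for all `k ∈ {0, …, d - r}`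
(no condition if `r > d`). -/
def SatisfiesRecurrence {d r : ℕ} (h : Fin (d + 1) → ℂ) (q : Fin (r + 1) → ℂ) : Prop :=
  ∀ (k : ℕ) (hk : k + r ≤ d),
    ∑ j : Fin (r + 1), q j * h ⟨k + (j : ℕ), by have := j.isLt; omega⟩ = 0

/-- The first characteristic degree of `h`: the smallest `r` such that some non-zero vector
`(q₀, …, q_r)` gives a linear recurrence satisfied by `h`. -/
def firstCharDegree {d : ℕ} (h : Fin (d + 1) → ℂ) : ℕ :=
  sInf {r : ℕ | ∃ q : Fin (r + 1) → ℂ, q ≠ 0 ∧ SatisfiesRecurrence h q}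

/-- The infimum above is over a non-empty set, hence attained. -/
theorem firstCharDegree_spec {d : ℕ} (h : Fin (d + 1) → ℂ) :
    ∃ q : Fin (firstCharDegree h + 1) → ℂ, q ≠ 0 ∧ SatisfiesRecurrence h q :=
  Nat.sInf_mem (s := {r : ℕ | ∃ q : Fin (r + 1) → ℂ, q ≠ 0 ∧ SatisfiesRecurrence h q})
    ⟨d + 1, fun _ => 1, fun h0 => one_ne_zero (congrFun h0 0), fun k hk => by omega⟩

/-- `q` is a characteristic vector of `h`: non-zero, of length `r + 1` where `r` is the first
characteristic degree of `h`, and `h` satisfies the recurrence with coefficients `q`. -/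
structure IsCharacteristicVector {d r : ℕ} (h : Fin (d + 1) → ℂ) (q : Fin (r + 1) → ℂ) :
    Prop where
  degree_eq : firstCharDegree h = r
  ne_zero : q ≠ 0
  recurrence : SatisfiesRecurrence h q

/-- The characteristic polynomial `q(z) = q₀ + q₁ z + ⋯ + q_r z^r`. -/
def characteristicPolynomial {r : ℕ} (q : Fin (r + 1) → ℂ) : ℂ[X] :=
  ∑ j : Fin (r + 1), C (q j) * X ^ (j : ℕ)

/-- The sequence `h₀, …, h_d, p₀, …, p_{d-1}` of length `2d + 1`: the known values followed by
the completed values `h_{d+1}, …, h_{2d}`. -/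
def completedSequence {d : ℕ} (h : Fin (d + 1) → ℂ) (p : Fin d → ℂ) (k : Fin (2 * d + 1)) : ℂ :=
  if hk : (k : ℕ) ≤ d then h ⟨k, by omega⟩
  else p ⟨(k : ℕ) - (d + 1), by have := k.isLt; omega⟩

/-- The `(d+1) × (d+1)` Hankel matrix of the completed sequence. -/
def hankelCompletion {d : ℕ} (h : Fin (d + 1) → ℂ) (p : Fin d → ℂ) :
    Matrix (Fin (d + 1)) (Fin (d + 1)) ℂ :=
  Matrix.of fun i j =>
    completedSequence h p ⟨(i : ℕ) + (j : ℕ), by have := i.isLt; have := j.isLt; omega⟩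

/-- The recursive continuation: for `k > d - r` (and `k + r ≤ 2d`),
`h_{k+r} = -(1/q_r) (q₀ h_k + ⋯ + q_{r-1} h_{k+r-1})`. -/
def IsRecursiveCompletion {d r : ℕ} (h : Fin (d + 1) → ℂ) (q : Fin (r + 1) → ℂ)
    (p : Fin d → ℂ) : Prop :=
  ∀ (k : ℕ) (_ : d < k + r) (hk : k + r ≤ 2 * d),
    completedSequence h p ⟨k + r, by omega⟩ =
      -(1 / q (Fin.last r)) *
        ∑ j : Fin r, q j.castSucc *
          completedSequence h p ⟨k + (j : ℕ), by have := j.isLt; omega⟩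

/-- The nuclear norm of a complex matrix: the sum of its singular values. -/
def nuclearNorm {n : ℕ} (A : Matrix (Fin n) (Fin n) ℂ) : ℝ :=
  ∑ i ∈ Finset.range n, (Matrix.toEuclideanLin A).singularValues i

end

/-! ### Trace duality and subgradients of the nuclear norm -/

section Duality

open InnerProductSpace Module

variable {E : Type*} [NormedAddCommGroup E] [InnerProductSpace ℂ E] [FiniteDimensional ℂ E]

/-! If all roots are small, the normalized characteristic vector is close to the last unit vector,
so its shifts put vectors close to `e_r, …, e_d` into the kernel of the recursive completion `A`.
Any other completion is `A + M`, with `M` Hankel and supported on the antidiagonals beyond `d`.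
Since `2r ≤ d + 1`, `M` vanishes on the top left `r × r` block, and each of those antidiagonals
meets the block with both indices at least `r`.

The polar part `W` of `A` is a subgradient of the nuclear norm at `A`. It inherits the kernel of
`A`, and its range lies in that of `A`, so its entries off the top left block are small and it pairs
weakly with `M`. A rank one operator built from the kernel of `A` can be added to `W` without
leaving the unit ball, and it detects the largest entry of `M`. Hence the nuclear norm strictly
increases (`sum_singularValues_add_le`, `nuclearNorm_lt_nuclearNorm_add`).

The recurrence on columns bounds the rank above by `r`; minimality of the characteristic degree
bounds it below for every completion. -/

theorem trace_adjoint_comp_eq_sum {ι : Type*} [Fintype ι] (b : OrthonormalBasis ι ℂ E)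
    (Z T : E →ₗ[ℂ] E) :
    LinearMap.trace ℂ E (LinearMap.adjoint Z ∘ₗ T) = ∑ i, inner ℂ (Z (b i)) (T (b i)) := by
  rw [LinearMap.trace_eq_sum_inner _ b]
  exact Finset.sum_congr rfl fun i _ => by
    rw [LinearMap.comp_apply, LinearMap.adjoint_inner_right]

/-- An orthonormal basis diagonalizing `T† T`. -/
theorem exists_rightSingularBasis (T : E →ₗ[ℂ] E) {n : ℕ} (hn : finrank ℂ E = n) :
    ∃ v : OrthonormalBasis (Fin n) ℂ E, (∀ i : Fin n, ‖T (v i)‖ = T.singularValues i) ∧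
      ∀ (i : Fin n) (x : E),
        inner ℂ (T (v i)) (T x) = (T.singularValues i : ℂ) ^ 2 * inner ℂ (v i) x := by
  have hT := T.isSymmetric_adjoint_comp_self
  have key : ∀ (i : Fin n) (x : E), inner ℂ (T (hT.eigenvectorBasis hn i)) (T x) =
      (T.singularValues i : ℂ) ^ 2 * inner ℂ (hT.eigenvectorBasis hn i) x := by
    intro i x
    have h1 := hT.apply_eigenvectorBasis hn i
    rw [← LinearMap.adjoint_inner_left, ← LinearMap.comp_apply, h1, inner_smul_left,
      ← T.sq_singularValues_fin hn i]
    simp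
  refine ⟨hT.eigenvectorBasis hn, fun i => ?_, key⟩
  have h2 := key i (hT.eigenvectorBasis hn i)
  rw [inner_self_eq_norm_sq_to_K, inner_self_eq_norm_sq_to_K,
    (hT.eigenvectorBasis hn).norm_eq_one] at h2
  have h3 : ‖T (hT.eigenvectorBasis hn i)‖ ^ 2 = T.singularValues i ^ 2 := by
    simp only [Complex.coe_algebraMap, Complex.ofReal_one, one_pow, mul_one] at h2
    exact_mod_cast h2
  exact (pow_left_inj₀ (norm_nonneg _) (T.singularValues_nonneg i) two_ne_zero).1 h3

/-- Trace duality: contractions pair with `T` to at most the nuclear norm. -/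
theorem re_trace_adjoint_comp_le_sum_singularValues (Z T : E →ₗ[ℂ] E) {n : ℕ}
    (hn : finrank ℂ E = n) (hZ : ∀ x, ‖Z x‖ ≤ ‖x‖) :
    (LinearMap.trace ℂ E (LinearMap.adjoint Z ∘ₗ T)).re ≤
      ∑ i ∈ Finset.range n, T.singularValues i := by
  obtain ⟨v, hv, -⟩ := exists_rightSingularBasis T hn
  rw [trace_adjoint_comp_eq_sum v, Complex.re_sum, ← Fin.sum_univ_eq_sum_range]
  refine Finset.sum_le_sum fun i _ => ?_
  calc (inner ℂ (Z (v i)) (T (v i))).re ≤ ‖inner ℂ (Z (v i)) (T (v i))‖ := Complex.re_le_norm _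
    _ ≤ ‖Z (v i)‖ * ‖T (v i)‖ := norm_inner_le_norm _ _
    _ ≤ 1 * ‖T (v i)‖ := by
        gcongr
        simpa using hZ (v i)
    _ = T.singularValues i := by rw [one_mul, hv]

/-- The partial isometry in the polar decomposition of `T`. -/
theorem exists_polar_partialIsometry (T : E →ₗ[ℂ] E) {n : ℕ} (hn : finrank ℂ E = n) :
    ∃ W : E →ₗ[ℂ] E, (∀ x, ‖W x‖ ≤ ‖x‖) ∧ (∀ x, T x = 0 → W x = 0) ∧
      (∀ a, (∀ x, inner ℂ a (T x) = 0) → ∀ x, inner ℂ a (W x) = 0) ∧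
      (LinearMap.trace ℂ E (LinearMap.adjoint W ∘ₗ T)).re =
        ∑ i ∈ Finset.range n, T.singularValues i := by
  obtain ⟨v, hv, hin⟩ := exists_rightSingularBasis T hn
  set σ : Fin n → ℝ := fun i => T.singularValues i with hσ
  -- Since `0⁻¹ = 0`, indices with `σ i = 0` drop out, which makes `W` a partial isometry vanishing
  -- on the kernel of `T`.
  let W : E →ₗ[ℂ] E := ∑ i, ((σ i : ℂ)⁻¹) • (innerSL ℂ (v i)).toLinearMap.smulRight (T (v i))
  have hW : ∀ x, W x = ∑ i, ((σ i : ℂ)⁻¹ * inner ℂ (v i) x) • T (v i) := by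
    intro x
    simp [W, LinearMap.sum_apply, smul_smul]
  have hTv : ∀ i j, inner ℂ (T (v i)) (T (v j)) = if i = j then (σ i : ℂ) ^ 2 else 0 := by
    intro i j
    rw [hin, orthonormal_iff_ite.1 v.orthonormal]
    simp [hσ]
  have hWv : ∀ i, W (v i) = (σ i : ℂ)⁻¹ • T (v i) := by
    intro i
    rw [hW, Finset.sum_eq_single i]
    · simp
    · intro j _ hj
      rw [orthonormal_iff_ite.1 v.orthonormal, if_neg hj]
      simp
    · simp
  refine ⟨W, fun x => ?_, fun x hx => ?_, fun a ha x => ?_, ?_⟩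
  · refine le_of_sq_le_sq ?_ (norm_nonneg _)
    have h1 : ((‖W x‖ ^ 2 : ℝ) : ℂ) = ((∑ i, ((σ i)⁻¹ * σ i) ^ 2 * ‖inner ℂ (v i) x‖ ^ 2 : ℝ) : ℂ) := by
      have := inner_self_eq_norm_sq_to_K (𝕜 := ℂ) (W x)
      simp only [Complex.coe_algebraMap] at this
      push_cast
      rw [← this, hW, sum_inner]
      refine Finset.sum_congr rfl fun i _ => ?_
      rw [inner_sum, Finset.sum_eq_single i]
      · rw [inner_smul_left, inner_smul_right, hTv, if_pos rfl, ← Complex.conj_mul']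
        simp only [map_mul, map_inv₀, Complex.conj_ofReal]
        ring
      · intro j _ hj
        rw [inner_smul_left, inner_smul_right, hTv, if_neg (Ne.symm hj)]
        simp
      · simp
    have h2 : ‖W x‖ ^ 2 = ∑ i, ((σ i)⁻¹ * σ i) ^ 2 * ‖inner ℂ (v i) x‖ ^ 2 := by
      exact_mod_cast h1
    rw [h2, ← v.sum_sq_norm_inner_right x]
    refine Finset.sum_le_sum fun i _ => ?_
    by_cases h0 : σ i = 0
    · simp [h0]
    · simp [inv_mul_cancel₀ h0]
  · rw [hW]
    refine Finset.sum_eq_zero fun i _ => ?_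
    have := hin i x
    rw [hx, inner_zero_right, eq_comm, mul_eq_zero] at this
    rcases this with h | h
    · have : (σ i : ℂ) = 0 := pow_eq_zero_iff two_ne_zero |>.1 h
      simp [this]
    · simp [h]
  · rw [hW, inner_sum]
    exact Finset.sum_eq_zero fun i _ => by rw [inner_smul_right, ha, mul_zero]
  · rw [trace_adjoint_comp_eq_sum v, Complex.re_sum, ← Fin.sum_univ_eq_sum_range]
    refine Finset.sum_congr rfl fun i _ => ?_
    rw [hWv, inner_smul_left, hTv, if_pos rfl]
    have : (starRingEnd ℂ) (σ i : ℂ)⁻¹ * (σ i : ℂ) ^ 2 = ((σ i : ℝ) : ℂ) := by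
      by_cases h0 : σ i = 0
      · simp [h0]
      · have h0' : (σ i : ℂ) ≠ 0 := by exact_mod_cast h0
        simp only [map_inv₀, Complex.conj_ofReal]
        field_simp
    rw [this, Complex.ofReal_re]

/-- First-order lower bound for the nuclear norm of a perturbation: the subgradient `W` of the
nuclear norm at `T` may be augmented by a rank one operator `a ⊗ b` with `T b = 0` and
`a ⊥ range T`. -/
theorem sum_singularValues_add_le (T N W : E →ₗ[ℂ] E) {n : ℕ} (hn : finrank ℂ E = n)
    (hW : ∀ x, ‖W x‖ ≤ ‖x‖) (hWk : ∀ x, T x = 0 → W x = 0)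
    (hWr : ∀ a, (∀ x, inner ℂ a (T x) = 0) → ∀ x, inner ℂ a (W x) = 0)
    (hWt : (LinearMap.trace ℂ E (LinearMap.adjoint W ∘ₗ T)).re =
      ∑ i ∈ Finset.range n, T.singularValues i)
    (a b : E) (ha : ‖a‖ ≤ 1) (hb : ‖b‖ ≤ 1) (hTb : T b = 0) (haT : ∀ x, inner ℂ a (T x) = 0) :
    ∑ i ∈ Finset.range n, T.singularValues i +
        (LinearMap.trace ℂ E (LinearMap.adjoint W ∘ₗ N)).re + ‖inner ℂ a (N b)‖ ≤
      ∑ i ∈ Finset.range n, (T + N).singularValues i := by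
  -- The phase `c` turns the pairing of the rank one operator with `N` into its modulus.
  obtain ⟨c, hc, hcz⟩ : ∃ c : ℂ, ‖c‖ ≤ 1 ∧
      (starRingEnd ℂ) c * inner ℂ a (N b) = (‖inner ℂ a (N b)‖ : ℂ) := by
    generalize inner ℂ a (N b) = z
    by_cases hz : z = 0
    · exact ⟨0, by simp, by simp [hz]⟩
    · have hz' : (‖z‖ : ℂ) ≠ 0 := by simpa using hz
      refine ⟨z / ‖z‖, by simp [hz], ?_⟩
      rw [map_div₀, Complex.conj_ofReal, div_mul_eq_mul_div, Complex.conj_mul']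
      field_simp
  let R : E →ₗ[ℂ] E := (innerSL ℂ b).toLinearMap.smulRight (c • a)
  have hR : ∀ x, R x = inner ℂ b x • c • a := fun x => by simp [R]
  have hRtr : ∀ S : E →ₗ[ℂ] E, LinearMap.trace ℂ E (LinearMap.adjoint R ∘ₗ S) =
      (starRingEnd ℂ) c * inner ℂ a (S b) := by
    intro S
    set e := stdOrthonormalBasis ℂ E
    rw [trace_adjoint_comp_eq_sum e]
    have h1 : S b = ∑ i, inner ℂ (e i) b • S (e i) := by
      conv_lhs => rw [← e.sum_repr' b]
      simp [map_sum]
    rw [h1, inner_sum, Finset.mul_sum]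
    refine Finset.sum_congr rfl fun i _ => ?_
    rw [hR, inner_smul_left, inner_smul_left, inner_smul_right, inner_conj_symm]
    ring
  -- Pythagoras on both sides: `W x ⊥ R x` because `a ⊥ range W`, and `W` sees only `x - t • b`
  -- because `W b = 0`.
  have hZ : ∀ x, ‖(W + R) x‖ ≤ ‖x‖ := by
    intro x
    refine le_of_sq_le_sq ?_ (norm_nonneg _)
    set t : ℂ := inner ℂ b x with ht
    have h1 : inner ℂ (W x) (R x) = 0 := by
      rw [hR, inner_smul_right, inner_smul_right, ← inner_conj_symm (W x) a, hWr a haT]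
      simp
    have h2 : W x = W (x - t • b) := by
      rw [map_sub, map_smul, hWk b hTb]
      simp
    have h3 : ‖(W + R) x‖ ^ 2 = ‖W x‖ ^ 2 + ‖R x‖ ^ 2 := by
      rw [LinearMap.add_apply, sq, sq, sq]
      exact norm_add_sq_eq_norm_sq_add_norm_sq_of_inner_eq_zero _ _ h1
    have h4 : ‖R x‖ ≤ ‖t‖ := by
      rw [hR, norm_smul, norm_smul]
      calc ‖t‖ * (‖c‖ * ‖a‖) ≤ ‖t‖ * (1 * 1) := by gcongr
        _ = ‖t‖ := by ring
    have h5 : ‖x - t • b‖ ^ 2 = ‖x‖ ^ 2 - 2 * ‖t‖ ^ 2 + ‖t‖ ^ 2 * ‖b‖ ^ 2 := by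
      rw [@norm_sub_sq ℂ, inner_smul_right, ← inner_conj_symm, ← ht, Complex.mul_conj',
        norm_smul, mul_pow]
      congr 3
      norm_cast
    have h6 : ‖W x‖ ^ 2 ≤ ‖x - t • b‖ ^ 2 := by
      rw [h2]
      gcongr
      exact hW _
    have h7 : ‖R x‖ ^ 2 ≤ ‖t‖ ^ 2 := by gcongr
    have h8 : ‖t‖ ^ 2 * ‖b‖ ^ 2 ≤ ‖t‖ ^ 2 * 1 := by
      gcongr
      exact pow_le_one₀ (norm_nonneg _) hb
    linarith
  have := re_trace_adjoint_comp_le_sum_singularValues (W + R) (T + N) hn hZ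
  have h9 : LinearMap.trace ℂ E (LinearMap.adjoint (W + R) ∘ₗ (T + N)) =
      LinearMap.trace ℂ E (LinearMap.adjoint W ∘ₗ T) +
      LinearMap.trace ℂ E (LinearMap.adjoint W ∘ₗ N) + (‖inner ℂ a (N b)‖ : ℂ) := by
    rw [map_add, LinearMap.add_comp, map_add, hRtr, LinearMap.comp_add, map_add,
      LinearMap.add_apply, hTb, zero_add, hcz]
  rw [h9, Complex.add_re, Complex.add_re, hWt, Complex.ofReal_re] at this
  exact this

end Duality

/-! ### Perturbation of a symmetric matrix with almost coordinate kernel vectors -/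

theorem norm_inner_toEuclideanLin_le {n : ℕ} (M : Matrix (Fin n) (Fin n) ℂ) {m : ℝ}
    (hM : ∀ i j, ‖M i j‖ ≤ m) (u x : EuclideanSpace ℂ (Fin n)) :
    ‖inner ℂ u (Matrix.toEuclideanLin M x)‖ ≤ n ^ 2 * m * ‖u‖ * ‖x‖ := by
  have h1 : inner ℂ u (Matrix.toEuclideanLin M x) =
      ∑ i, ∑ j, M i j * x j * (starRingEnd ℂ) (u i) := by
    simp only [PiLp.inner_apply, Matrix.toLpLin_apply, Matrix.mulVec, dotProduct,
      RCLike.inner_apply, Finset.sum_mul]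
  rw [h1]
  calc ‖∑ i, ∑ j, M i j * x j * (starRingEnd ℂ) (u i)‖
      ≤ ∑ i : Fin n, ∑ j : Fin n, m * ‖x‖ * ‖u‖ := by
        refine norm_sum_le_of_le _ fun i _ => norm_sum_le_of_le _ fun j _ => ?_
        rw [norm_mul, norm_mul, RCLike.norm_conj]
        have := PiLp.norm_apply_le x j
        have := PiLp.norm_apply_le u i
        have := (norm_nonneg _).trans (hM i j)
        gcongr
        exact hM i j
    _ = n ^ 2 * m * ‖u‖ * ‖x‖ := by
        simp
        ring

/-- For a symmetric complex matrix this makes conjugates of kernel vectors orthogonal to the range,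
so one kernel vector controls both a row and a column of `W`. -/
theorem inner_toLp_star_toEuclideanLin {n : ℕ} (A : Matrix (Fin n) (Fin n) ℂ) (b : Fin n → ℂ)
    (x : EuclideanSpace ℂ (Fin n)) :
    inner ℂ (WithLp.toLp 2 (star b)) (Matrix.toEuclideanLin A x) =
      inner ℂ (WithLp.toLp 2 (star (A.transpose.mulVec b))) x := by
  simp only [Matrix.toLpLin_apply, EuclideanSpace.inner_eq_star_dotProduct, star_star]
  rw [dotProduct_comm, Matrix.dotProduct_mulVec, Matrix.mulVec_transpose, dotProduct_comm]

theorem norm_toLp_star {n : ℕ} (b : Fin n → ℂ) :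
    ‖(WithLp.toLp 2 (star b) : EuclideanSpace ℂ (Fin n))‖ =
      ‖(WithLp.toLp 2 b : EuclideanSpace ℂ (Fin n))‖ := by
  simp [EuclideanSpace.norm_eq]

/-- If the kernel of the symmetric matrix `A` contains vectors close to the unit vectors indexed
by `J`, then any perturbation whose entries vanish outside `J` and are largest in `J × J` strictly
increases the nuclear norm. -/
theorem nuclearNorm_lt_nuclearNorm_add {n : ℕ} (A M : Matrix (Fin n) (Fin n) ℂ)
    (hA : A.transpose = A) (J : Set (Fin n)) {ε m : ℝ} (hε : 0 ≤ ε) (hε' : ε * n ^ 2 ≤ 1 / 20)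
    (hker : ∀ j ∈ J, ∃ b : Fin n → ℂ, A.mulVec b = 0 ∧
      ‖(WithLp.toLp 2 (b - Pi.single j 1) : EuclideanSpace ℂ (Fin n))‖ ≤ ε)
    (hm : 0 < m) (hM : ∀ i j, ‖M i j‖ ≤ m) (hMJ : ∀ i j, i ∉ J → j ∉ J → M i j = 0)
    {i₀ j₀ : Fin n} (hi₀ : i₀ ∈ J) (hj₀ : j₀ ∈ J) (hM₀ : ‖M i₀ j₀‖ = m) :
    nuclearNorm A < nuclearNorm (A + M) := by
  set T := Matrix.toEuclideanLin A with hT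
  set N := Matrix.toEuclideanLin M with hN
  have hn : Module.finrank ℂ (EuclideanSpace ℂ (Fin n)) = n := by simp
  have hn1 : (1 : ℝ) ≤ n := by exact_mod_cast i₀.pos
  have hε1 : ε ≤ 1 / 20 := by nlinarith [one_le_pow₀ hn1 (n := 2)]
  obtain ⟨W, hW, hWk, hWr, hWt⟩ := exists_polar_partialIsometry T hn
  let e : Fin n → EuclideanSpace ℂ (Fin n) := fun j => WithLp.toLp 2 (Pi.single j 1)
  have he : ∀ j, ‖e j‖ = 1 := fun j => by simp [e]
  have hTz : ∀ b : Fin n → ℂ, A.mulVec b = 0 → T (WithLp.toLp 2 b) = 0 := fun b hb => by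
    simp [T, hb]
  have hstar : ∀ b : Fin n → ℂ, A.mulVec b = 0 →
      ∀ x, inner ℂ (WithLp.toLp 2 (star b) : EuclideanSpace ℂ (Fin n)) (T x) = 0 := by
    intro b hb x
    rw [hT, inner_toLp_star_toEuclideanLin, hA, hb]
    simp
  have hestar : ∀ j, (WithLp.toLp 2 (star (Pi.single j (1 : ℂ))) : EuclideanSpace ℂ (Fin n)) = e j := by
    intro j
    simp only [e]
    congr 1
    ext k
    by_cases h : k = j
    · subst h; simp
    · simp [h]
  have hestar' : ∀ (b : Fin n → ℂ) j,
      ‖(WithLp.toLp 2 (star b) : EuclideanSpace ℂ (Fin n)) - e j‖ =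
        ‖(WithLp.toLp 2 (b - Pi.single j 1) : EuclideanSpace ℂ (Fin n))‖ := by
    intro b j
    rw [← norm_toLp_star (b - Pi.single j 1), star_sub, ← hestar j, WithLp.toLp_sub]
  -- the entries of `W` are small outside of `Jᶜ × Jᶜ`
  have hWcol : ∀ i j, j ∈ J → ‖inner ℂ (e i) (W (e j))‖ ≤ ε := by
    intro i j hj
    obtain ⟨b, hb, hbe⟩ := hker j hj
    have h1 : W (e j) = - W (WithLp.toLp 2 (b - Pi.single j 1)) := by
      rw [WithLp.toLp_sub, map_sub, hWk _ (hTz b hb)]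
      simp [e]
    calc ‖inner ℂ (e i) (W (e j))‖ ≤ ‖e i‖ * ‖W (e j)‖ := norm_inner_le_norm _ _
      _ ≤ ε := by
        rw [he, one_mul, h1, norm_neg]
        exact (hW _).trans hbe
  have hWrow : ∀ i j, i ∈ J → ‖inner ℂ (e i) (W (e j))‖ ≤ ε := by
    intro i j hi
    obtain ⟨b, hb, hbe⟩ := hker i hi
    have h1 : inner ℂ (e i) (W (e j)) = - inner ℂ (WithLp.toLp 2 (star b) - e i) (W (e j)) := by
      rw [inner_sub_left, hWr _ (hstar b hb)]
      simp
    rw [h1, norm_neg]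
    calc _ ≤ ‖(WithLp.toLp 2 (star b) : EuclideanSpace ℂ (Fin n)) - e i‖ * ‖W (e j)‖ :=
          norm_inner_le_norm _ _
      _ ≤ ε * 1 := by
        rw [hestar']
        gcongr
        simpa [he] using hW (e j)
      _ = ε := mul_one _
  have hNe : ∀ j, N (e j) = ∑ i, M i j • e i := by
    intro j
    ext k
    simp [N, e, Matrix.toLpLin_apply, Matrix.mulVec_single, Pi.single_apply]
  have htr : ‖LinearMap.trace ℂ _ (LinearMap.adjoint W ∘ₗ N)‖ ≤ n ^ 2 * (m * ε) := by
    rw [trace_adjoint_comp_eq_sum (EuclideanSpace.basisFun (Fin n) ℂ)]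
    calc _ ≤ ∑ j : Fin n, ∑ i : Fin n, m * ε := by
          refine norm_sum_le_of_le _ fun j _ => ?_
          have : EuclideanSpace.basisFun (Fin n) ℂ j = e j := by simp [e]
          rw [this, hNe, inner_sum]
          refine norm_sum_le_of_le _ fun i _ => ?_
          rw [inner_smul_right, norm_mul, ← inner_conj_symm, RCLike.norm_conj]
          by_cases hij : i ∉ J ∧ j ∉ J
          · rw [hMJ i j hij.1 hij.2, norm_zero, zero_mul]
            positivity
          · have : ‖inner ℂ (e i) (W (e j))‖ ≤ ε := by
              by_cases hi : i ∈ J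
              · exact hWrow i j hi
              · exact hWcol i j (by tauto)
            gcongr
            exact hM i j
      _ = n ^ 2 * (m * ε) := by
          simp
          ring
  obtain ⟨a, hAa, hae⟩ := hker i₀ hi₀
  obtain ⟨b, hAb, hbe⟩ := hker j₀ hj₀
  set a' : EuclideanSpace ℂ (Fin n) := WithLp.toLp 2 (star a) with ha'
  set b' : EuclideanSpace ℂ (Fin n) := WithLp.toLp 2 b with hb'
  have hae' : ‖a' - e i₀‖ ≤ ε := by rw [ha', hestar']; exact hae
  have hbe' : ‖b' - e j₀‖ ≤ ε := by simpa only [WithLp.toLp_sub] using hbe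
  have hbn : ‖b'‖ ≤ 2 := by
    have := norm_le_norm_add_norm_sub (e j₀) b'
    rw [he, norm_sub_rev] at this
    linarith
  have han : ‖a'‖ ≤ 2 := by
    have := norm_le_norm_add_norm_sub (e i₀) a'
    rw [he, norm_sub_rev] at this
    linarith
  -- Replacing `a'` by its unit vector costs `2 n² m ε` (as `‖b'‖ ≤ 2`), and replacing `b'` costs
  -- `n² m ε`.
  have hmain : m - 3 * (n ^ 2 * m * ε) ≤ ‖inner ℂ a' (N b')‖ := by
    have h1 : inner ℂ (e i₀) (N (e j₀)) = M i₀ j₀ := by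
      simp [N, e, Matrix.toLpLin_apply, PiLp.inner_apply]
    have h2 : inner ℂ (e i₀) (N (e j₀)) = inner ℂ a' (N b') -
        (inner ℂ (a' - e i₀) (N b') + inner ℂ (e i₀) (N (b' - e j₀))) := by
      rw [map_sub, inner_sub_left, inner_sub_right]
      ring
    have h3 := norm_inner_toEuclideanLin_le M hM (a' - e i₀) b'
    have h4 := norm_inner_toEuclideanLin_le M hM (e i₀) (b' - e j₀)
    have h5 : n ^ 2 * m * ‖a' - e i₀‖ * ‖b'‖ ≤ n ^ 2 * m * ε * 2 := by gcongr
    have h6 : n ^ 2 * m * ‖e i₀‖ * ‖b' - e j₀‖ ≤ n ^ 2 * m * 1 * ε := by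
      rw [he]
      gcongr
    have h7 := norm_sub_le (inner ℂ a' (N b'))
      (inner ℂ (a' - e i₀) (N b') + inner ℂ (e i₀) (N (b' - e j₀)))
    have h8 := norm_add_le (inner ℂ (a' - e i₀) (N b')) (inner ℂ (e i₀) (N (b' - e j₀)))
    rw [← h2, h1, hM₀] at h7
    linarith
  -- The halves bring `a'` and `b'` into the unit ball. The gain is then at least `(1/4)(17/20) m`,
  -- against a loss of at most `m/20`.
  have hfin := sum_singularValues_add_le T N W hn hW hWk hWr hWt ((1 / 2 : ℂ) • a')
    ((1 / 2 : ℂ) • b') (by rw [norm_smul]; norm_num; linarith)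
    (by rw [norm_smul]; norm_num; linarith) (by rw [map_smul, hTz b hAb, smul_zero])
    (fun x => by rw [inner_smul_left, hstar a hAa, mul_zero])
  have hquarter : ‖inner ℂ ((1 / 2 : ℂ) • a') (N ((1 / 2 : ℂ) • b'))‖ =
      1 / 4 * ‖inner ℂ a' (N b')‖ := by
    rw [map_smul, inner_smul_left, inner_smul_right, norm_mul, norm_mul]
    norm_num
    ring
  have hre := (abs_le.1 ((Complex.abs_re_le_norm _).trans htr)).1
  have hTN : Matrix.toEuclideanLin (A + M) = T + N := map_add _ _ _
  unfold nuclearNorm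
  rw [hTN]
  rw [hquarter] at hfin
  have h10 : n ^ 2 * (m * ε) ≤ m * (1 / 20) := by
    calc n ^ 2 * (m * ε) = m * (ε * n ^ 2) := by ring
      _ ≤ m * (1 / 20) := by gcongr
  have h11 : n ^ 2 * m * ε = n ^ 2 * (m * ε) := by ring
  rw [h11] at hmain
  linarith

/-! ### Coefficients of the characteristic polynomial -/

theorem coeff_characteristicPolynomial {r : ℕ} (q : Fin (r + 1) → ℂ) (j : Fin (r + 1)) :
    (characteristicPolynomial q).coeff j = q j := by
  simp [characteristicPolynomial, coeff_C_mul, coeff_X_pow, Fin.val_inj]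

theorem natDegree_characteristicPolynomial {r : ℕ} (q : Fin (r + 1) → ℂ)
    (hq : q (Fin.last r) ≠ 0) : (characteristicPolynomial q).natDegree = r := by
  refine le_antisymm ?_ ?_
  · refine natDegree_sum_le_of_forall_le _ _ fun j _ => ?_
    exact (natDegree_C_mul_X_pow_le _ _).trans (by have := j.isLt; omega)
  · refine le_natDegree_of_ne_zero ?_
    have := coeff_characteristicPolynomial q (Fin.last r)
    rw [Fin.val_last] at this
    rwa [this]

/-- Small roots force small normalized coefficients. -/
theorem norm_coeff_div_last_le {r : ℕ} (q : Fin (r + 1) → ℂ) (hq : q (Fin.last r) ≠ 0) {ρ : ℝ}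
    (hρ0 : 0 ≤ ρ) (hρ1 : ρ ≤ 1)
    (hroot : ∀ z : ℂ, (characteristicPolynomial q).IsRoot z → ‖z‖ < ρ) (j : Fin r) :
    ‖q j.castSucc / q (Fin.last r)‖ ≤ ρ * 2 ^ r := by
  set P := C (q (Fin.last r))⁻¹ * characteristicPolynomial q with hP
  have hq' := inv_ne_zero hq
  have hlast := coeff_characteristicPolynomial q (Fin.last r)
  rw [Fin.val_last] at hlast
  have hdeg : P.natDegree = r := by
    rw [hP, natDegree_C_mul hq', natDegree_characteristicPolynomial q hq]
  have hmonic : P.Monic := by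
    rw [Monic, leadingCoeff, hdeg, hP, coeff_C_mul, hlast, inv_mul_cancel₀ hq]
  have h := coeff_le_of_roots_le (f := RingHom.id ℂ) (B := ρ) (j : ℕ) hmonic
    (IsAlgClosed.splits _) (fun z hz => by
      rw [map_id, mem_roots hmonic.ne_zero, IsRoot, hP, eval_mul, eval_C, mul_eq_zero] at hz
      exact (hroot z (hz.resolve_left hq')).le)
  have hj : P.coeff j = q j.castSucc / q (Fin.last r) := by
    have := coeff_characteristicPolynomial q j.castSucc
    rw [Fin.val_castSucc] at this
    rw [hP, coeff_C_mul, this, div_eq_inv_mul]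
  rw [map_id, hj, hdeg] at h
  refine h.trans ?_
  -- As `j < r`, at least one factor `ρ` survives.
  have h1 : ρ ^ (r - (j : ℕ)) ≤ ρ := pow_le_of_le_one hρ0 hρ1 (by have := j.isLt; omega)
  have h2 : ((r.choose j : ℕ) : ℝ) ≤ 2 ^ r := by exact_mod_cast Nat.choose_le_two_pow r j
  gcongr

/-! ### The recursive continuation -/

/-- The sequence `h` continued by the recurrence with coefficients `q`. -/
noncomputable def recursiveExtension {d r : ℕ} (h : Fin (d + 1) → ℂ) (q : Fin (r + 1) → ℂ)
    (hrd : r ≤ d) (k : ℕ) : ℂ :=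
  if hk : k ≤ d then h ⟨k, by omega⟩
  else -(1 / q (Fin.last r)) *
    ∑ j : Fin r, q j.castSucc * recursiveExtension h q hrd (k - r + (j : ℕ))
termination_by k
decreasing_by
  have := j.isLt
  omega

theorem recursiveExtension_of_le {d r : ℕ} (h : Fin (d + 1) → ℂ) (q : Fin (r + 1) → ℂ)
    (hrd : r ≤ d) {k : ℕ} (hk : k ≤ d) : recursiveExtension h q hrd k = h ⟨k, by omega⟩ := by
  rw [recursiveExtension, dif_pos hk]

theorem recursiveExtension_of_lt {d r : ℕ} (h : Fin (d + 1) → ℂ) (q : Fin (r + 1) → ℂ)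
    (hrd : r ≤ d) {k : ℕ} (hk : d < k + r) : recursiveExtension h q hrd (k + r) =
      -(1 / q (Fin.last r)) *
        ∑ j : Fin r, q j.castSucc * recursiveExtension h q hrd (k + (j : ℕ)) := by
  rw [recursiveExtension, dif_neg (by omega), Nat.add_sub_cancel]

theorem sum_mul_recursiveExtension {d r : ℕ} (h : Fin (d + 1) → ℂ) (q : Fin (r + 1) → ℂ)
    (hrd : r ≤ d) (hrec : SatisfiesRecurrence h q) (hq : q (Fin.last r) ≠ 0) (k : ℕ) :
    ∑ j : Fin (r + 1), q j * recursiveExtension h q hrd (k + (j : ℕ)) = 0 := by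
  by_cases hk : k + r ≤ d
  · rw [← hrec k hk]
    refine Finset.sum_congr rfl fun j _ => ?_
    rw [recursiveExtension_of_le h q hrd (by have := j.isLt; omega)]
  · rw [Fin.sum_univ_castSucc]
    simp only [Fin.val_castSucc, Fin.val_last]
    rw [recursiveExtension_of_lt h q hrd (by omega)]
    field_simp
    ring

theorem completedSequence_recursiveExtension {d r : ℕ} (h : Fin (d + 1) → ℂ)
    (q : Fin (r + 1) → ℂ) (hrd : r ≤ d) (k : Fin (2 * d + 1)) :
    completedSequence h (fun i : Fin d => recursiveExtension h q hrd (d + 1 + i)) k =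
      recursiveExtension h q hrd k := by
  unfold completedSequence
  split_ifs with hk
  · rw [recursiveExtension_of_le h q hrd hk]
  · dsimp only
    congr 1
    omega

theorem hankelCompletion_transpose {d : ℕ} (h : Fin (d + 1) → ℂ) (p : Fin d → ℂ) :
    (hankelCompletion h p).transpose = hankelCompletion h p := by
  ext i j
  simp [hankelCompletion, add_comm]

/-! ### Rank bounds -/

/-- Every completion has rank at least the first characteristic degree. -/
theorem firstCharDegree_le_rank_hankelCompletion {d : ℕ} (h : Fin (d + 1) → ℂ)
    (hd : firstCharDegree h ≤ d) (p : Fin d → ℂ) :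
    firstCharDegree h ≤ (hankelCompletion h p).rank := by
  rcases Nat.eq_zero_or_pos (firstCharDegree h) with h0 | h0
  · rw [h0]; exact Nat.zero_le _
  obtain ⟨s, hs⟩ : ∃ s, firstCharDegree h = s + 1 := ⟨_, (Nat.succ_pred_eq_of_pos h0).symm⟩
  rw [hs]
  -- A dependence among the first `s + 1` columns, read in the rows `k ≤ d - s`, involves only given
  -- entries and would be a recurrence of order `s`.
  let c : Fin (s + 1) → Fin (d + 1) → ℂ := fun j =>
    (hankelCompletion h p).col ⟨j, by have := j.isLt; omega⟩
  have hli : LinearIndependent ℂ c := by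
    by_contra hli
    obtain ⟨g, hg, j, hj⟩ := Fintype.not_linearIndependent_iff.1 hli
    have : firstCharDegree h ≤ s := by
      refine Nat.sInf_le ⟨g, fun h0 => hj (congrFun h0 j), fun k hk => ?_⟩
      have h1 := congrFun hg ⟨k, by omega⟩
      rw [Finset.sum_apply] at h1
      refine Eq.trans (Finset.sum_congr rfl fun i _ => ?_) h1
      have := i.isLt
      rw [Pi.smul_apply, smul_eq_mul]
      simp only [c, Matrix.col, Matrix.transpose_apply, hankelCompletion, Matrix.of_apply,
        completedSequence]
      rw [dif_pos (by omega)]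
    omega
  rw [Matrix.rank_eq_finrank_span_cols, ← Fintype.card_fin (s + 1), ← finrank_span_eq_card hli]
  refine Submodule.finrank_mono (Submodule.span_mono ?_)
  rintro _ ⟨j, rfl⟩
  exact ⟨_, rfl⟩

/-- A matrix whose columns satisfy a linear recurrence of order `r` has rank at most `r`. -/
theorem rank_le_of_col_recurrence {m n r : ℕ} (A : Matrix (Fin m) (Fin n) ℂ) (c : Fin r → ℂ)
    (hA : ∀ (s : ℕ) (hs : s + r < n), A.col ⟨s + r, hs⟩ =
      ∑ j : Fin r, c j • A.col ⟨s + j, by have := j.isLt; omega⟩) : A.rank ≤ r := by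
  rw [Matrix.rank_eq_finrank_span_cols]
  let S : Set (Fin m → ℂ) := Set.range fun j : {j : Fin n // (j : ℕ) < r} => A.col j
  have hspan : ∀ (k : ℕ) (hk : k < n), A.col ⟨k, hk⟩ ∈ Submodule.span ℂ S := by
    intro k
    induction k using Nat.strong_induction_on with
    | _ k ih =>
      intro hk
      by_cases hkr : k < r
      · exact Submodule.subset_span ⟨⟨⟨k, hk⟩, hkr⟩, rfl⟩
      · obtain ⟨s, rfl⟩ : ∃ s, k = s + r := ⟨k - r, by omega⟩
        rw [hA s hk]
        refine Submodule.sum_mem _ fun j _ => Submodule.smul_mem _ _ (ih _ ?_ _)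
        have := j.isLt
        omega
  calc _ ≤ Module.finrank ℂ (Submodule.span ℂ S) := by
        refine Submodule.finrank_mono (Submodule.span_le.2 ?_)
        rintro _ ⟨k, rfl⟩
        exact hspan k k.isLt
    _ ≤ Fintype.card {j : Fin n // (j : ℕ) < r} := finrank_range_le_card _
    _ ≤ Fintype.card (Fin r) :=
        Fintype.card_le_of_injective (fun j => (⟨j.1, j.2⟩ : Fin r)) fun i j hij => by
          simpa [Subtype.ext_iff, Fin.ext_iff] using hij
    _ = r := Fintype.card_fin r

/-! ### Kernel of the recursive completion and strict minimality -/

theorem hankelCompletion_recursiveExtension_apply {d r : ℕ} (h : Fin (d + 1) → ℂ)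
    (q : Fin (r + 1) → ℂ) (hrd : r ≤ d) (i j : Fin (d + 1)) :
    hankelCompletion h (fun i : Fin d => recursiveExtension h q hrd (d + 1 + i)) i j =
      recursiveExtension h q hrd (i + j) := by
  rw [hankelCompletion, Matrix.of_apply, completedSequence_recursiveExtension]

/-- The columns of the recursive completion satisfy the recurrence. -/
theorem sum_smul_col_hankelCompletion {d r : ℕ} (h : Fin (d + 1) → ℂ) (q : Fin (r + 1) → ℂ)
    (hrd : r ≤ d) (hrec : SatisfiesRecurrence h q) (hq : q (Fin.last r) ≠ 0) (s : ℕ)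
    (hs : s + r < d + 1) :
    ∑ j : Fin (r + 1), (q j / q (Fin.last r)) •
      (hankelCompletion h (fun i : Fin d => recursiveExtension h q hrd (d + 1 + i))).col
        ⟨s + j, by have := j.isLt; omega⟩ = 0 := by
  ext i
  have h1 := sum_mul_recursiveExtension h q hrd hrec hq (i + s)
  rw [Finset.sum_apply, Pi.zero_apply, ← mul_zero (q (Fin.last r))⁻¹, ← h1, Finset.mul_sum]
  refine Finset.sum_congr rfl fun j _ => ?_
  rw [Pi.smul_apply, smul_eq_mul, Matrix.col, Matrix.transpose_apply,
    hankelCompletion_recursiveExtension_apply, add_assoc, div_eq_inv_mul, mul_assoc]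

/-- The recursive completion annihilates the shifts of the normalized characteristic vector,
which are close to unit vectors when the characteristic roots are small. -/
theorem exists_mulVec_eq_zero_norm_sub_single_le {d r : ℕ} (h : Fin (d + 1) → ℂ)
    (q : Fin (r + 1) → ℂ) (hrd : r ≤ d) (hrec : SatisfiesRecurrence h q)
    (hq : q (Fin.last r) ≠ 0) {δ : ℝ} (hδ : ∀ j : Fin r, ‖q j.castSucc / q (Fin.last r)‖ ≤ δ)
    (k : Fin (d + 1)) (hk : r ≤ k) :
    ∃ b : Fin (d + 1) → ℂ,
      (hankelCompletion h (fun i : Fin d => recursiveExtension h q hrd (d + 1 + i))).mulVec b = 0 ∧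
      ‖(WithLp.toLp 2 (b - Pi.single k 1) : EuclideanSpace ℂ (Fin (d + 1)))‖ ≤ r * δ := by
  obtain ⟨s, hs⟩ : ∃ s, (k : ℕ) = s + r := ⟨k - r, by omega⟩
  have hsr : s + r < d + 1 := hs ▸ k.isLt
  refine ⟨∑ j : Fin (r + 1), (q j / q (Fin.last r)) •
    Pi.single ⟨s + j, by have := j.isLt; omega⟩ 1, ?_, ?_⟩
  · rw [Matrix.mulVec_sum, ← sum_smul_col_hankelCompletion h q hrd hrec hq s hsr]
    refine Finset.sum_congr rfl fun j _ => ?_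
    rw [Matrix.mulVec_smul, Matrix.mulVec_single_one]
  · have hk' : k = ⟨s + (Fin.last r : ℕ), hsr⟩ := Fin.ext hs
    rw [Fin.sum_univ_castSucc, div_self hq, one_smul, ← hk', add_sub_cancel_right,
      WithLp.toLp_sum]
    refine (norm_sum_le_of_le (n := fun _ => δ) _ fun j _ => ?_).trans_eq (by simp)
    rw [WithLp.toLp_smul, norm_smul]
    simpa using hδ j

theorem isRecursiveCompletion_recursiveExtension {d r : ℕ} (h : Fin (d + 1) → ℂ)
    (q : Fin (r + 1) → ℂ) (hrd : r ≤ d) :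
    IsRecursiveCompletion h q (fun i : Fin d => recursiveExtension h q hrd (d + 1 + i)) := by
  intro k hk hk'
  simp only [completedSequence_recursiveExtension]
  exact recursiveExtension_of_lt h q hrd hk

theorem completedSequence_sub {d : ℕ} (h : Fin (d + 1) → ℂ) (x p : Fin d → ℂ)
    (k : Fin (2 * d + 1)) :
    completedSequence h x k - completedSequence h p k = completedSequence 0 (x - p) k := by
  unfold completedSequence
  split_ifs <;> simp

/-- Nuclear norm of the recursive completion is strictly smaller than that of any other
completion, provided that the lower coefficients of the recurrence are small. -/
theorem nuclearNorm_recursiveExtension_lt {d r : ℕ} (hr : 2 * r < d + 2) (h : Fin (d + 1) → ℂ)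
    (q : Fin (r + 1) → ℂ) (hrd : r ≤ d) (hrec : SatisfiesRecurrence h q)
    (hq : q (Fin.last r) ≠ 0) {δ : ℝ} (hδ0 : 0 ≤ δ)
    (hδ : ∀ j : Fin r, ‖q j.castSucc / q (Fin.last r)‖ ≤ δ)
    (hδ' : r * δ * (d + 1 : ℕ) ^ 2 ≤ 1 / 20) (x : Fin d → ℂ)
    (hx : x ≠ fun i : Fin d => recursiveExtension h q hrd (d + 1 + i)) :
    nuclearNorm (hankelCompletion h (fun i : Fin d => recursiveExtension h q hrd (d + 1 + i))) <
      nuclearNorm (hankelCompletion h x) := by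
  set p : Fin d → ℂ := fun i : Fin d => recursiveExtension h q hrd (d + 1 + i) with hp
  obtain ⟨k₁, hk₁⟩ := Function.ne_iff.1 hx
  have : Nonempty (Fin d) := ⟨k₁⟩
  obtain ⟨k₀, hk₀⟩ := Finite.exists_max fun k => ‖(x - p) k‖
  have hpos : 0 < ‖(x - p) k₀‖ :=
    (norm_pos_iff.2 (sub_ne_zero.2 hk₁)).trans_le (hk₀ k₁)
  have hM : ∀ i j, (hankelCompletion h x - hankelCompletion h p) i j =
      completedSequence 0 (x - p) ⟨(i : ℕ) + (j : ℕ), by omega⟩ := fun i j => by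
    rw [← completedSequence_sub h]
    rfl
  rw [← add_sub_cancel (hankelCompletion h p) (hankelCompletion h x)]
  have hk₀d := k₀.isLt
  -- The antidiagonal of a largest changed entry has index at least `d + 1 ≥ 2r`, so it contains a
  -- position with both indices at least `r`.
  obtain ⟨i₀, j₀, hi₀, hj₀, hi₀r, hj₀r, hij⟩ : ∃ i₀ j₀ : ℕ, i₀ < d + 1 ∧ j₀ < d + 1 ∧ r ≤ i₀ ∧
      r ≤ j₀ ∧ i₀ + j₀ = d + 1 + k₀ := by
    rcases le_total (d + 1 + (k₀ : ℕ)) (d + r) with hle | hle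
    · exact ⟨d + 1 + k₀ - r, r, by omega⟩
    · exact ⟨d, 1 + k₀, by omega⟩
  refine nuclearNorm_lt_nuclearNorm_add (ε := r * δ) (m := ‖(x - p) k₀‖) _ _
    (hankelCompletion_transpose h p) {k | r ≤ (k : ℕ)}
    (by positivity) hδ' (fun k hk =>
      exists_mulVec_eq_zero_norm_sub_single_le h q hrd hrec hq hδ k hk) hpos (fun i j => ?_)
    (fun i j hi hj => ?_) (i₀ := ⟨i₀, hi₀⟩) (j₀ := ⟨j₀, hj₀⟩) hi₀r hj₀r ?_
  · rw [hM, completedSequence]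
    split_ifs
    · simp
    · exact hk₀ _
  -- Two indices below `r` sum to at most `2r - 2 ≤ d`, where the entries are prescribed.
  · simp only [Set.mem_ofPred_eq, not_le] at hi hj
    rw [hM, completedSequence, dif_pos (by dsimp only; omega), Pi.zero_apply]
  · rw [hM, completedSequence, dif_neg (by dsimp only; omega)]
    exact congrArg (fun k => ‖(x - p) k‖) (Fin.ext (by dsimp only; omega))

/-! ### Rank of the recursive completion and choice of `ρ` -/

theorem rank_hankelCompletion_recursiveExtension_le {d r : ℕ} (h : Fin (d + 1) → ℂ)
    (q : Fin (r + 1) → ℂ) (hrd : r ≤ d) (hrec : SatisfiesRecurrence h q)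
    (hq : q (Fin.last r) ≠ 0) :
    (hankelCompletion h (fun i : Fin d => recursiveExtension h q hrd (d + 1 + i))).rank ≤ r := by
  refine rank_le_of_col_recurrence _ (fun j => -(q j.castSucc / q (Fin.last r))) fun s hs => ?_
  have h1 := sum_smul_col_hankelCompletion h q hrd hrec hq s hs
  rw [Fin.sum_univ_castSucc, div_self hq, one_smul] at h1
  simp only [neg_smul, Finset.sum_neg_distrib]
  exact eq_neg_of_add_eq_zero_right h1

theorem theorem2 (d r : ℕ) (hr : 2 * r < d + 2) :
    ∃ ρ : ℝ, 0 < ρ ∧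
      ∀ (h : Fin (d + 1) → ℂ) (q : Fin (r + 1) → ℂ),
        IsCharacteristicVector h q → q (Fin.last r) ≠ 0 →
        (∀ z : ℂ, (characteristicPolynomial q).IsRoot z → ‖z‖ < ρ) →
        ∃ p : Fin d → ℂ,
          IsRecursiveCompletion h q p ∧
          (∀ p' : Fin d → ℂ,
            IsMinOn (fun x : Fin d → ℂ => nuclearNorm (hankelCompletion h x)) Set.univ p' ↔
              p' = p) ∧
          (hankelCompletion h p).rank = r ∧
          (∀ p' : Fin d → ℂ, r ≤ (hankelCompletion h p').rank) := by
  have hrd : r ≤ d := by omega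
  -- With `ρ = 1 / (20 K)` the coefficients are at most `ρ 2 ^ r`, and the kernel vectors lie within
  -- `ε = r ρ 2 ^ r` of unit vectors, so `ε (d + 1)² ≤ 1/20`. The factor `r + 1` instead of `r`
  -- keeps `K ≥ 1` when `r = 0`.
  set K : ℝ := (r + 1) * 2 ^ r * (d + 1 : ℕ) ^ 2 with hK
  have hK1 : 1 ≤ K := by
    have h1 : (1 : ℝ) ≤ r + 1 := by linarith [Nat.cast_nonneg (α := ℝ) r]
    have h2 : (1 : ℝ) ≤ 2 ^ r := one_le_pow₀ (by norm_num)
    have h3 : (1 : ℝ) ≤ (d + 1 : ℕ) ^ 2 := one_le_pow₀ (by simp)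
    exact one_le_mul_of_one_le_of_one_le (one_le_mul_of_one_le_of_one_le h1 h2) h3
  have hρ0 : 0 < 1 / (20 * K) := by positivity
  have hρ1 : 1 / (20 * K) ≤ 1 := by
    rw [div_le_one (by positivity)]
    linarith
  refine ⟨1 / (20 * K), hρ0, fun h q hchar hq hroot => ?_⟩
  have hδ := norm_coeff_div_last_le q hq hρ0.le hρ1 hroot
  have hδ' : r * (1 / (20 * K) * 2 ^ r) * (d + 1 : ℕ) ^ 2 ≤ (1 / 20 : ℝ) := by
    calc r * (1 / (20 * K) * 2 ^ r) * (d + 1 : ℕ) ^ 2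
        ≤ (r + 1) * (1 / (20 * K) * 2 ^ r) * (d + 1 : ℕ) ^ 2 := by
          gcongr
          linarith
      _ = 1 / (20 * K) * K := by rw [hK]; ring
      _ = 1 / 20 := by field_simp
  have hlt := nuclearNorm_recursiveExtension_lt hr h q hrd hchar.recurrence hq (by positivity) hδ hδ'
  have hrank : ∀ p' : Fin d → ℂ, r ≤ (hankelCompletion h p').rank := by
    have := firstCharDegree_le_rank_hankelCompletion h (hchar.degree_eq.trans_le hrd)
    rwa [hchar.degree_eq] at this
  refine ⟨fun i : Fin d => recursiveExtension h q hrd (d + 1 + i),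
    isRecursiveCompletion_recursiveExtension h q hrd, fun p' => ⟨fun hmin => ?_, ?_⟩,
    le_antisymm (rank_hankelCompletion_recursiveExtension_le h q hrd hchar.recurrence hq)
      (hrank _), hrank⟩
  · by_contra hne
    exact (hlt p' hne).not_ge (isMinOn_iff.1 hmin _ (Set.mem_univ _))
  · rintro rfl
    refine isMinOn_iff.2 fun x _ => ?_
    by_cases hx : x = fun i : Fin d => recursiveExtension h q hrd (d + 1 + i)
    · rw [hx]
    · exact (hlt x hx).le
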